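/- Let $f_Z:\mathbb R\to[0,\infty)$ be a log-concave probability density, let $s\subset\{1,\dots,p\}$ be a fixed support set, partitioned as $s=s_{\rm dif}\cup s_{\rm eq}$ with $s_{\rm dif}\cap s_{\rm eq}=\emptyset$ and $s_{\rm dif}\neq\emptyset$, put $k=|s|$, and fix the vector of non-zero entries $b_s\in\mathbb C^{k}$, indexed by $s$. Consider $n$ measurements of the phase retrieval model conditioned on $\beta_s=b_s$: $$Y^{(i)}=|\langle X^{(i)}_s,b_s\rangle|^2+Z^{(i)},\qquad i=1,\dots,n,$$ where all entries of the measurement vectors $X^{(i)}\in\mathbb C^p$ are i.i.d. $\mathcal{CN}(0,1)$, and the $Z^{(i)}$ are i.i.d. with density $f_Z$ and independent of the measurement vectors. For a single measurement write $$f_{Y|X_{s_{\rm dif}}X_{s_{\rm eq}}\beta_s}(y|x_{s_{\rm dif}},x_{s_{\rm eq}},b_s)=f_Z\big(y-|\langle x_{s_{\rm dif}},b_{s_{\rm dif}}\rangle+\langle x_{s_{\rm eq}},b_{s_{\rm eq}}\rangle|^2\big),$$ let $f_{Y|X_{s_{\rm eq}}\beta_s}(y|x_{s_{\rm eq}},b_s)$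 be its average over $x_{s_{\rm dif}}$ with i.i.d. $\mathcal{CN}(0,1)$ entries, and let $f_{Y|\beta_s}(y|b_s)$ be its average over all of $x_s$ with i.i.d. $\mathcal{CN}(0,1)$ entries. The information density is $$i(x_{s_{\rm dif}};y|x_{s_{\rm eq}},b_s)=\log\frac{f_{Y|X_{s_{\rm dif}}X_{s_{\rm eq}}\beta_s}(y|x_{s_{\rm dif}},x_{s_{\rm eq}},b_s)}{f_{Y|X_{s_{\rm eq}}\beta_s}(y|x_{s_{\rm eq}},b_s)},\qquad i^n(\mathbf X_{s_{\rm dif}};\mathbf Y|\mathbf X_{s_{\rm eq}},\beta_s=b_s)=\sum_{i=1}^n i(X^{(i)}_{s_{\rm dif}};Y^{(i)}|X^{(i)}_{s_{\rm eq}},b_s),$$ and $I_{s_{\rm dif},s_{\rm eq}}(b_s)=I(X_{s_{\rm dif}};Y|X_{s_{\rm eq}},\beta_s=b_s)$ is the mean of $i(X_{s_{\rm dif}};Y|X_{s_{\rm eq}},b_s)$ for a single measurement. Put $r(u)=u-\log(1+u)$ for $u>-1$ and $r(u)=+\infty$ otherwise (with $e^{-\infty}=0$ and $0\cdot\infty=0$),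 and $$D(b_s)=\sup_{t>0}\,(\|f_{Y|\beta_s}(\cdot|b_s)\|_\infty+1)^{-t}\int_{\mathbb R}t\,f_{Y|\beta_s}(y|b_s)^t\,dy,\qquad C(b_s)=150\max\{2D(b_s)(\|f_Z\|_\infty+1),\,1\},$$ where $\|\cdot\|_\infty$ denotes the supremum. Then $C(b_s)<\infty$, the single-measurement information density is integrable, and for all $\mu>0$ $$\mathbb P\big[i^n(\mathbf X_{s_{\rm dif}};\mathbf Y|\mathbf X_{s_{\rm eq}},\beta_s=b_s)-nI_{s_{\rm dif},s_{\rm eq}}(b_s)\le-2nC(b_s)\mu\big]\le e^{-nC(b_s)r(\mu)}+e^{-nC(b_s)r(-\mu)},$$ $$\mathbb P\big[i^n(\mathbf X_{s_{\rm dif}};\mathbf Y|\mathbf X_{s_{\rm eq}},\beta_s=b_s)-nI_{s_{\rm dif},s_{\rm eq}}(b_s)\ge 2nC(b_s)\mu\big]\le e^{-nC(b_s)r(\mu)}+e^{-nC(b_s)r(-\mu)}.$$ -/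

import Mathlib

open MeasureTheory ProbabilityTheory
open scoped ENNReal

noncomputable section

/-- A function on the real line is log-concave: nonnegative, and
`f x ^ a * f y ^ c ≤ f (a x + c y)` for all weights `a, c > 0` with `a + c = 1`. -/
def IsLogConcave (f : ℝ → ℝ) : Prop :=
  (∀ x, 0 ≤ f x) ∧
    ∀ x y a c : ℝ, 0 < a → 0 < c → a + c = 1 → f x ^ a * f y ^ c ≤ f (a * x + c * y)

/-- `f` is a log-concave probability density on the real line. -/
structure IsLogConcaveDensity (f : ℝ → ℝ) : Prop where
  measurable : Measurable f
  logConcave : IsLogConcave f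
  lintegral_eq_one : ∫⁻ x, ENNReal.ofReal (f x) = 1

/-- The standard circularly-symmetric complex Gaussian law `CN(0,1)`: real and imaginary parts are
independent real Gaussians of mean `0` and variance `1/2`. -/
def stdComplexGaussian : Measure ℂ :=
  ((gaussianReal 0 (1 / 2)).prod (gaussianReal 0 (1 / 2))).map Complex.measurableEquivRealProd.symm

/-- The law of the noise with density `fZ`. -/
def noiseLaw (fZ : ℝ → ℝ) : Measure ℝ := volume.withDensity fun z => ENNReal.ofReal (fZ z)

/-- The inner product `⟨x_t, b_t⟩` of the subvectors indexed by `t`. -/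
def subInner {p : ℕ} (t : Finset (Fin p)) (x b : Fin p → ℂ) : ℂ :=
  ∑ j ∈ t, x j * star (b j)

/-- The noiseless observation `|⟨x_s, b_s⟩|²`. -/
def phaseless {p : ℕ} (s : Finset (Fin p)) (b x : Fin p → ℂ) : ℝ :=
  ‖subInner s x b‖ ^ 2

/-- Joint law of the `n × p` measurement matrix, with i.i.d. `CN(0,1)` entries, and of the `n` noise
variables, i.i.d. with density `fZ` and independent of the matrix. -/
def designNoiseLaw (n p : ℕ) (fZ : ℝ → ℝ) : Measure ((Fin n → Fin p → ℂ) × (Fin n → ℝ)) :=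
  (Measure.pi fun _ : Fin n => Measure.pi fun _ : Fin p => stdComplexGaussian).prod
    (Measure.pi fun _ : Fin n => noiseLaw fZ)

/-- Law of one measurement vector and its noise. -/
def singleLaw (p : ℕ) (fZ : ℝ → ℝ) : Measure ((Fin p → ℂ) × ℝ) :=
  (Measure.pi fun _ : Fin p => stdComplexGaussian).prod (noiseLaw fZ)

/-- The conditional density of one observation `Y` at `y` given the measurement subvectors
`X_dif = x_dif`, `X_eq = x_eq` and the non-zero entries `b`:
`f_Z (y - |⟨x_dif, b_dif⟩ + ⟨x_eq, b_eq⟩|²)`. -/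
def densityFull {p : ℕ} (fZ : ℝ → ℝ) (b : Fin p → ℂ) (sdif seq : Finset (Fin p))
    (x : Fin p → ℂ) (y : ℝ) : ℝ :=
  fZ (y - ‖subInner sdif x b + subInner seq x b‖ ^ 2)

/-- The conditional density of one observation `Y` at `y` given `X_eq = x_eq` and the non-zero
entries `b`: the `X_dif` part is averaged out under its `CN(0,1)` product law. -/
def densityEq {p : ℕ} (fZ : ℝ → ℝ) (b : Fin p → ℂ) (sdif seq : Finset (Fin p))
    (x : Fin p → ℂ) (y : ℝ) : ℝ :=
  ∫ u : sdif → ℂ, fZ (y - ‖∑ j : sdif, u j * star (b j) + subInner seq x b‖ ^ 2)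
    ∂(Measure.pi fun _ : sdif => stdComplexGaussian)

/-- The density of one observation `Y` at `y` given only the non-zero entries `b` on the
support `s`. -/
def densityMarginal {p : ℕ} (fZ : ℝ → ℝ) (b : Fin p → ℂ) (s : Finset (Fin p)) (y : ℝ) : ℝ :=
  ∫ u : s → ℂ, fZ (y - ‖∑ j : s, u j * star (b j)‖ ^ 2)
    ∂(Measure.pi fun _ : s => stdComplexGaussian)

/-- The single-letter information density `i(x_dif; y | x_eq, b)`. -/
def infoDensity {p : ℕ} (fZ : ℝ → ℝ) (b : Fin p → ℂ) (sdif seq : Finset (Fin p))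
    (x : Fin p → ℂ) (y : ℝ) : ℝ :=
  Real.log (densityFull fZ b sdif seq x y / densityEq fZ b sdif seq x y)

/-- The `n`-letter information density, for the measurement vectors `x i` and observations `y i`. -/
def infoDensityN {p n : ℕ} (fZ : ℝ → ℝ) (b : Fin p → ℂ) (sdif seq : Finset (Fin p))
    (x : Fin n → Fin p → ℂ) (y : Fin n → ℝ) : ℝ :=
  ∑ i, infoDensity fZ b sdif seq (x i) (y i)

/-- The information density of one random measurement, as a function of the measurement vector and
of the noise. -/
def infoDensityOfNoise {p : ℕ} (fZ : ℝ → ℝ) (b : Fin p → ℂ) (s sdif seq : Finset (Fin p))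
    (q : (Fin p → ℂ) × ℝ) : ℝ :=
  infoDensity fZ b sdif seq q.1 (phaseless s b q.1 + q.2)

/-- The conditional mutual information `I(X_dif; Y | X_eq, β_s = b)`: the mean of the single-letter
information density. -/
def condMutualInfo {p : ℕ} (fZ : ℝ → ℝ) (b : Fin p → ℂ) (s sdif seq : Finset (Fin p)) : ℝ :=
  ∫ q, infoDensityOfNoise fZ b s sdif seq q ∂(singleLaw p fZ)

/-- The supremum of a nonnegative function, as an extended nonnegative real. -/
def supNorm (f : ℝ → ℝ) : ℝ≥0∞ := ⨆ y, ENNReal.ofReal (f y)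

/-- `D(b) = sup_{t > 0} (‖f_{Y|β=b}‖_∞ + 1)^{-t} ∫ t f_{Y|β=b}^t`. -/
def constD {p : ℕ} (fZ : ℝ → ℝ) (b : Fin p → ℂ) (s : Finset (Fin p)) : ℝ≥0∞ :=
  ⨆ (t : ℝ) (_ : 0 < t), (supNorm (densityMarginal fZ b s) + 1) ^ (-t) *
    ∫⁻ y, ENNReal.ofReal (t * densityMarginal fZ b s y ^ t)

/-- `C(b) = 150 max {2 D(b) (‖f_Z‖_∞ + 1), 1}`. -/
def constC {p : ℕ} (fZ : ℝ → ℝ) (b : Fin p → ℂ) (s : Finset (Fin p)) : ℝ≥0∞ :=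
  150 * max (2 * constD fZ b s * (supNorm fZ + 1)) 1

open Classical in
/-- `r(u) = u - log (1 + u)` for `u > -1`, and `+∞` otherwise. -/
def rateFun (u : ℝ) : EReal :=
  if -1 < u then ((u - Real.log (1 + u) : ℝ) : EReal) else ⊤

/-- The tail bound `exp (-n C r(μ)) + exp (-n C r(-μ))`, where `exp (-∞) = 0`. -/
def tailBound (n : ℕ) (C μ : ℝ) : ℝ≥0∞ :=
  EReal.exp (-(((n * C : ℝ) : EReal) * rateFun μ)) +
    EReal.exp (-(((n * C : ℝ) : EReal) * rateFun (-μ)))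

end

/-! The information density of one measurement is `U = log (f_Z(Z) / g)`, where `g` is the
conditional density of `Y` given `X_eq`, evaluated at the random observation. Everything reduces to
one exponential moment, `E exp(|U|/2) ≤ κ` with `κ = 2 + 2 D (M + 1)` and `M = ‖f_Z‖_∞`, followed by
a Chernoff bound for i.i.d. sums.

Both `f_Z` and `g` are at most `M`, so `exp(|U|/2) ≤ √(M / f_Z(Z)) + √(M / g)`. The first term has
mean `√M ∫ √f_Z`, which midpoint log-concavity bounds by 2. For the second, integrating out `X_dif`
produces a factor `g`, leaving `∫ √g dy` averaged over `X_eq`; Jensen replaces `g` by its average,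
the marginal density of `Y`, and the term `t = 1/2` in the supremum defining `D` bounds the result
by `2 D (M + 1)`.

The moment gives `E exp(s (U - E U) / 2) ≤ exp(s² κ)` for `0 ≤ s ≤ 1`. Since `2 κ ≤ C`, the choice
`s = μ / (1 + μ)` yields the rate `C r(μ)`; applying this to `U` and `-U` gives the two tails.

Finiteness of `D` holds because log-concave densities decay exponentially and, by Fernique's
theorem, `|⟨X_s, b_s⟩|²` has an exponential moment, so the marginal density of `Y` has exponential
tails. -/

/-! ### Elementary inequalities for exp and log. -/

theorem Real.exp_mul_le_one_add_add {s : ℝ} (hs0 : 0 ≤ s) (hs1 : s ≤ 1) (y : ℝ) :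
    Real.exp (s * y) ≤ 1 + s * y + s ^ 2 * Real.exp |y| := by
  have h (x : ℝ) : HasSum (fun n : ℕ => x ^ (n + 2) / ((n + 2).factorial : ℝ))
      (Real.exp x - 1 - x) := by
    have h1 : HasSum (fun n : ℕ => x ^ n / (n.factorial : ℝ)) (Real.exp x) := by
      rw [Real.exp_eq_exp_ℝ]
      exact NormedSpace.expSeries_div_hasSum_exp x
    have h2 := (hasSum_nat_add_iff' 2).2 h1
    simpa [Finset.sum_range_succ, sub_sub] using h2
  -- Compare Taylor series term by term from order two on, where `s ^ (n + 2) ≤ s ^ 2`.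
  have hle : Real.exp (s * y) - 1 - s * y ≤ s ^ 2 * (Real.exp |y| - 1 - |y|) := by
    refine hasSum_le (fun n => ?_) (h (s * y)) ((h |y|).mul_left (s ^ 2))
    rw [← mul_div_assoc]
    gcongr
    rw [mul_pow]
    have h1 : y ^ (n + 2) ≤ |y| ^ (n + 2) := by
      rw [← abs_pow]; exact le_abs_self _
    have h2 : s ^ (n + 2) ≤ s ^ 2 := pow_le_pow_of_le_one hs0 hs1 (by omega)
    calc s ^ (n + 2) * y ^ (n + 2) ≤ s ^ (n + 2) * |y| ^ (n + 2) := by gcongr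
      _ ≤ s ^ 2 * |y| ^ (n + 2) := by gcongr
  nlinarith [mul_nonneg (sq_nonneg s) (abs_nonneg y), sq_nonneg s]

theorem Real.add_sq_div_two_le_neg_log_one_sub {x : ℝ} (h0 : 0 ≤ x) (h1 : x < 1) :
    x + x ^ 2 / 2 ≤ -Real.log (1 - x) := by
  have h := Real.hasSum_pow_div_log_of_abs_lt_one (x := x) (by rwa [abs_of_nonneg h0])
  have := sum_le_hasSum (Finset.range 2) (fun i _ => by positivity) h
  norm_num [Finset.sum_range_succ] at this
  linarith

/-! ### Chernoff bound from an exponential moment. -/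

section Concentration

variable {S : Type*} [MeasurableSpace S] {ρ : Measure S} {U : S → ℝ} {κ : ℝ}

theorem integrable_exp_abs_of_lintegral_le (hU : Measurable U)
    (hexp : ∫⁻ q, ENNReal.ofReal (Real.exp (|U q| / 2)) ∂ρ ≤ ENNReal.ofReal κ) :
    Integrable (fun q => Real.exp (|U q| / 2)) ρ := by
  refine ⟨by fun_prop, ?_⟩
  rw [hasFiniteIntegral_iff_ofReal (Filter.Eventually.of_forall fun q => (Real.exp_pos _).le)]
  exact hexp.trans_lt ENNReal.ofReal_lt_top

theorem integrable_of_lintegral_exp_abs_le (hU : Measurable U)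
    (hexp : ∫⁻ q, ENNReal.ofReal (Real.exp (|U q| / 2)) ∂ρ ≤ ENNReal.ofReal κ) :
    Integrable U ρ := by
  refine ((integrable_exp_abs_of_lintegral_le hU hexp).const_mul 2).mono'
    hU.aestronglyMeasurable (Filter.Eventually.of_forall fun q => ?_)
  have := Real.add_one_le_exp (|U q| / 2)
  rw [Real.norm_eq_abs]
  linarith

variable [IsProbabilityMeasure ρ]

/-- A random variable with an exponential moment has a sub-exponential moment generating
function. -/
theorem lintegral_exp_sub_integral_le (hU : Measurable U) (hκ : 0 ≤ κ)
    (hexp : ∫⁻ q, ENNReal.ofReal (Real.exp (|U q| / 2)) ∂ρ ≤ ENNReal.ofReal κ)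
    {s : ℝ} (hs0 : 0 ≤ s) (hs1 : s ≤ 1) :
    ∫⁻ q, ENNReal.ofReal (Real.exp (s / 2 * (U q - ∫ q, U q ∂ρ))) ∂ρ
      ≤ ENNReal.ofReal (Real.exp (s ^ 2 * κ)) := by
  have hiU := integrable_of_lintegral_exp_abs_le hU hexp
  have hiE := integrable_exp_abs_of_lintegral_le hU hexp
  have hE : ∫ q, Real.exp (|U q| / 2) ∂ρ ≤ κ := by
    rw [integral_eq_lintegral_of_nonneg_ae
      (Filter.Eventually.of_forall fun q => (Real.exp_pos _).le) (by fun_prop)]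
    exact ENNReal.toReal_le_of_le_ofReal hκ hexp
  set m := ∫ q, U q ∂ρ
  have hpt (q : S) : Real.exp (s / 2 * (U q - m)) ≤
      Real.exp (-(s / 2 * m)) * (1 + s / 2 * U q + s ^ 2 * Real.exp (|U q| / 2)) := by
    have h := Real.exp_mul_le_one_add_add hs0 hs1 (U q / 2)
    rw [abs_div, abs_two] at h
    have e : Real.exp (s / 2 * (U q - m)) = Real.exp (-(s / 2 * m)) * Real.exp (s * (U q / 2)) := by
      rw [← Real.exp_add]; ring_nf
    rw [e]
    gcongr
    linarith
  have hint : Integrable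
      (fun q => Real.exp (-(s / 2 * m)) * (1 + s / 2 * U q + s ^ 2 * Real.exp (|U q| / 2))) ρ :=
    (((integrable_const 1).add (hiU.const_mul _)).add (hiE.const_mul _)).const_mul _
  calc ∫⁻ q, ENNReal.ofReal (Real.exp (s / 2 * (U q - m))) ∂ρ
      ≤ ∫⁻ q, ENNReal.ofReal
          (Real.exp (-(s / 2 * m)) * (1 + s / 2 * U q + s ^ 2 * Real.exp (|U q| / 2))) ∂ρ :=
        lintegral_mono fun q => ENNReal.ofReal_le_ofReal (hpt q)
    _ = ENNReal.ofReal (∫ q,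
          Real.exp (-(s / 2 * m)) * (1 + s / 2 * U q + s ^ 2 * Real.exp (|U q| / 2)) ∂ρ) :=
        (ofReal_integral_eq_lintegral_ofReal hint
          (Filter.Eventually.of_forall fun q => (Real.exp_pos _).le.trans (hpt q))).symm
    _ ≤ _ := by
        apply ENNReal.ofReal_le_ofReal
        have hi1 : Integrable (fun q => 1 + s / 2 * U q) ρ :=
          (integrable_const 1).add (hiU.const_mul _)
        rw [integral_const_mul, integral_add hi1 (hiE.const_mul _),
          integral_add (integrable_const 1) (hiU.const_mul _),
          integral_const_mul, integral_const_mul]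
        simp only [integral_const, probReal_univ, smul_eq_mul, mul_one]
        -- The linear term is absorbed with `1 + x ≤ exp x`; its factor `exp (s m / 2)` then cancels
        -- the centering.
        have h1 : 1 + s / 2 * m + s ^ 2 * ∫ q, Real.exp (|U q| / 2) ∂ρ
            ≤ Real.exp (s / 2 * m + s ^ 2 * κ) := by
          have := Real.add_one_le_exp (s / 2 * m + s ^ 2 * κ)
          have := mul_le_mul_of_nonneg_left hE (sq_nonneg s)
          linarith
        calc _ ≤ Real.exp (-(s / 2 * m)) * Real.exp (s / 2 * m + s ^ 2 * κ) := by gcongr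
          _ = _ := by rw [← Real.exp_add]; ring_nf

theorem lintegral_pi_exp_sum {n : ℕ} {V : S → ℝ} (hV : Measurable V) :
    ∫⁻ q : Fin n → S, ENNReal.ofReal (Real.exp (∑ i, V (q i))) ∂(Measure.pi fun _ => ρ)
      = (∫⁻ q, ENNReal.ofReal (Real.exp (V q)) ∂ρ) ^ n := by
  have hind := iIndepFun_pi (μ := fun _ : Fin n => ρ)
    (X := fun _ q => ENNReal.ofReal (Real.exp (V q))) (fun i => by fun_prop)
  have := lintegral_prod_eq_prod_lintegral_of_indepFun Finset.univ _ hind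
    (fun i => by fun_prop)
  have e (q : Fin n → S) : ENNReal.ofReal (Real.exp (∑ i, V (q i)))
      = ∏ i, ENNReal.ofReal (Real.exp (V (q i))) := by
    rw [Real.exp_sum, ENNReal.ofReal_prod_of_nonneg fun i _ => (Real.exp_pos _).le]
  simp_rw [e]
  rw [this]
  have e2 (i : Fin n) : ∫⁻ q : Fin n → S, ENNReal.ofReal (Real.exp (V (q i)))
      ∂(Measure.pi fun _ => ρ) = ∫⁻ q, ENNReal.ofReal (Real.exp (V q)) ∂ρ :=
    (measurePreserving_eval (fun _ : Fin n => ρ) i).lintegral_comp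
      (f := fun x => ENNReal.ofReal (Real.exp (V x))) (by fun_prop)
  simp [e2]

/-- Chernoff bound for a sum of i.i.d. random variables with an exponential moment. -/
theorem measure_pi_le_sum_sub_le {n : ℕ} (hU : Measurable U) (hκ : 0 ≤ κ)
    (hexp : ∫⁻ q, ENNReal.ofReal (Real.exp (|U q| / 2)) ∂ρ ≤ ENNReal.ofReal κ)
    {C μ : ℝ} (hC : 2 * κ ≤ C) (hμ : 0 < μ) :
    (Measure.pi fun _ : Fin n => ρ)
        {q | 2 * n * C * μ ≤ ∑ i, U (q i) - n * ∫ q, U q ∂ρ}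
      ≤ ENNReal.ofReal (Real.exp (-(n * C * (μ - Real.log (1 + μ))))) := by
  set m := ∫ q, U q ∂ρ
  -- This Chernoff parameter satisfies `1 - θ = 1 / (1 + μ)` and `θ μ = μ - θ`, which turns the
  -- exponent into `μ - log (1 + μ)`.
  set θ := μ / (1 + μ) with hθ
  have hθ0 : 0 ≤ θ := by positivity
  have hθ1 : θ < 1 := by rw [hθ, div_lt_one (by positivity)]; linarith
  have hV : Measurable fun q => θ / 2 * (U q - m) := by fun_prop
  have hmark := meas_ge_le_lintegral_div (μ := Measure.pi fun _ : Fin n => ρ)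
    (f := fun q => ENNReal.ofReal (Real.exp (∑ i, θ / 2 * (U (q i) - m))))
    (ε := ENNReal.ofReal (Real.exp (n * C * θ * μ)))
    (Finset.measurable_fun_sum Finset.univ fun i _ =>
      hV.comp (measurable_pi_apply i)).exp.ennreal_ofReal.aemeasurable
    (by simp [Real.exp_pos]) ENNReal.ofReal_ne_top
  rw [lintegral_pi_exp_sum (V := fun q => θ / 2 * (U q - m)) hV] at hmark
  refine le_trans (measure_mono fun q hq => ?_) (hmark.trans ?_)
  · simp only [Set.mem_ofPred_eq] at hq ⊢
    apply ENNReal.ofReal_le_ofReal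
    apply Real.exp_le_exp.2
    rw [← Finset.mul_sum, Finset.sum_sub_distrib]
    simp only [Finset.sum_const, Finset.card_univ, Fintype.card_fin, nsmul_eq_mul]
    calc _ = θ / 2 * (2 * n * C * μ) := by ring
      _ ≤ _ := by gcongr
  · refine (ENNReal.div_le_div_right (pow_le_pow_left' (lintegral_exp_sub_integral_le hU hκ hexp
      hθ0 hθ1.le) n) _).trans ?_
    rw [← ENNReal.ofReal_pow (Real.exp_pos _).le, ← ENNReal.ofReal_div_of_pos (Real.exp_pos _),
      ← Real.exp_nat_mul, ← Real.exp_sub]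
    apply ENNReal.ofReal_le_ofReal
    apply Real.exp_le_exp.2
    -- The quadratic cost `θ² κ ≤ C θ² / 2` is at most `C (log (1 + μ) - θ)`; subtracting `C (μ -
    -- θ)` leaves `-C r(μ)`.
    have hlog : θ + θ ^ 2 / 2 ≤ Real.log (1 + μ) := by
      have h := Real.add_sq_div_two_le_neg_log_one_sub hθ0 hθ1
      have e : 1 - θ = (1 + μ)⁻¹ := by rw [hθ]; field_simp; ring
      rwa [e, Real.log_inv, neg_neg] at h
    have hθμ : θ * μ = μ - θ := by rw [hθ]; field_simp; ring
    have h1 : θ ^ 2 * κ ≤ C * (θ ^ 2 / 2) := by nlinarith [sq_nonneg θ]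
    have h2 : C * (θ ^ 2 / 2) ≤ C * (Real.log (1 + μ) - θ) :=
      mul_le_mul_of_nonneg_left (by linarith) (by linarith)
    have h3 : (n : ℝ) * (θ ^ 2 * κ) ≤ n * (C * (Real.log (1 + μ) - θ)) :=
      mul_le_mul_of_nonneg_left (h1.trans h2) n.cast_nonneg
    have e : n * C * θ * μ = n * (C * (μ - θ)) := by rw [← hθμ]; ring
    rw [e]
    linarith

end Concentration

/-! ### Log-concave densities: half-power integral, boundedness, exponential decay. -/

section LogConcave

variable {f : ℝ → ℝ}

theorem IsLogConcave.rpow_half_mul_le (hf : IsLogConcave f) (x y : ℝ) :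
    ENNReal.ofReal (f x) ^ (1 / 2 : ℝ) * ENNReal.ofReal (f y) ^ (1 / 2 : ℝ)
      ≤ ENNReal.ofReal (f (1 / 2 * x + 1 / 2 * y)) := by
  rw [ENNReal.ofReal_rpow_of_nonneg (hf.1 x) (by norm_num),
    ENNReal.ofReal_rpow_of_nonneg (hf.1 y) (by norm_num),
    ← ENNReal.ofReal_mul (Real.rpow_nonneg (hf.1 x) _)]
  exact ENNReal.ofReal_le_ofReal (hf.2 x y _ _ (by norm_num) (by norm_num) (by norm_num))

/-- Integrate `√(f x f y) ≤ f ((x + y) / 2)` over `y`; halving the variable contributes the factor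
2. -/
theorem IsLogConcaveDensity.rpow_half_mul_lintegral_le (hf : IsLogConcaveDensity f) (x : ℝ) :
    ENNReal.ofReal (f x) ^ (1 / 2 : ℝ) * ∫⁻ y, ENNReal.ofReal (f y) ^ (1 / 2 : ℝ) ≤ 2 := by
  have hm := hf.measurable
  rw [← lintegral_const_mul _ (by fun_prop)]
  calc _ ≤ ∫⁻ y, ENNReal.ofReal (f (1 / 2 * x + 1 / 2 * y)) :=
        lintegral_mono fun y => hf.logConcave.rpow_half_mul_le x y
    _ = ∫⁻ y, ENNReal.ofReal (f (1 / 2 * x + y)) ∂(volume.map fun y : ℝ => 1 / 2 * y) := by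
        rw [lintegral_map (by fun_prop) (by fun_prop)]
    _ = 2 * ∫⁻ y, ENNReal.ofReal (f (1 / 2 * x + y)) := by
        rw [Real.map_volume_mul_left (by norm_num), lintegral_smul_measure]
        norm_num
    _ = 2 := by
        rw [lintegral_add_left_eq_self (fun y => ENNReal.ofReal (f y)), hf.lintegral_eq_one,
          mul_one]

theorem IsLogConcaveDensity.lintegral_rpow_half_ne_zero (hf : IsLogConcaveDensity f) :
    ∫⁻ y, ENNReal.ofReal (f y) ^ (1 / 2 : ℝ) ≠ 0 := by
  have hm := hf.measurable
  intro h
  rw [lintegral_eq_zero_iff (by fun_prop)] at h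
  have h1 : ∫⁻ y, ENNReal.ofReal (f y) = 0 := by
    rw [lintegral_eq_zero_iff (by fun_prop)]
    filter_upwards [h] with y hy
    simpa [ENNReal.rpow_eq_zero_iff] using hy
  simp [hf.lintegral_eq_one] at h1

theorem ofReal_le_supNorm (f : ℝ → ℝ) (y : ℝ) : ENNReal.ofReal (f y) ≤ supNorm f :=
  le_iSup (fun y => ENNReal.ofReal (f y)) y

theorem IsLogConcaveDensity.supNorm_rpow_half_mul_lintegral_le (hf : IsLogConcaveDensity f) :
    supNorm f ^ (1 / 2 : ℝ) * ∫⁻ y, ENNReal.ofReal (f y) ^ (1 / 2 : ℝ) ≤ 2 := by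
  have h0 := hf.lintegral_rpow_half_ne_zero
  rw [← ENNReal.le_div_iff_mul_le (.inl h0) (.inr (by simp)), one_div,
    ENNReal.rpow_inv_le_iff (by norm_num), ← one_div]
  refine iSup_le fun y => ?_
  rw [← ENNReal.rpow_inv_le_iff (by norm_num), ← one_div,
    ENNReal.le_div_iff_mul_le (.inl h0) (.inr (by simp))]
  exact hf.rpow_half_mul_lintegral_le y

/-- An infinite supremum times the nonzero integral of `√f` would exceed 2. -/
theorem IsLogConcaveDensity.supNorm_ne_top (hf : IsLogConcaveDensity f) : supNorm f ≠ ⊤ := by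
  intro h
  have := hf.supNorm_rpow_half_mul_lintegral_le
  rw [h, ENNReal.top_rpow_of_pos (by norm_num),
    ENNReal.top_mul hf.lintegral_rpow_half_ne_zero] at this
  simp at this

theorem IsLogConcaveDensity.exists_pos (hf : IsLogConcaveDensity f) : ∃ x, 0 < f x := by
  by_contra! h
  have : ∫⁻ y, ENNReal.ofReal (f y) = 0 := by simp [fun y => ENNReal.ofReal_of_nonpos (h y)]
  simp [hf.lintegral_eq_one] at this

theorem IsLogConcaveDensity.supNorm_ne_zero (hf : IsLogConcaveDensity f) : supNorm f ≠ 0 := by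
  obtain ⟨x, hx⟩ := hf.exists_pos
  exact ((ENNReal.ofReal_pos.2 hx).trans_le (ofReal_le_supNorm f x)).ne'

theorem le_toReal_supNorm (h : supNorm f ≠ ⊤) (y : ℝ) : f y ≤ (supNorm f).toReal :=
  (ENNReal.ofReal_le_iff_le_toReal h).1 (ofReal_le_supNorm f y)

/-- Exponential decay to the right of an integrable bounded log-concave function. -/
theorem IsLogConcave.exists_le_exp_right (hf : IsLogConcave f)
    (hint : ∫⁻ x, ENNReal.ofReal (f x) ≠ ⊤) {x₀ M : ℝ} (hx₀ : 0 < f x₀) (hM : ∀ x, f x ≤ M) :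
    ∃ d > 0, ∀ z, x₀ ≤ z → f z ≤ M * Real.exp (1 - (z - x₀) / d) := by
  -- Somewhere to the right `f` drops by a factor `e`, since otherwise it would exceed a positive
  -- constant on a half-line. Beyond `x₁`, log-concavity propagates this rate; before `x₁`, the 1 in
  -- the exponent makes the bound `M` enough.
  obtain ⟨x₁, hx₁, hfx₁⟩ : ∃ x₁, x₀ < x₁ ∧ f x₁ ≤ f x₀ * Real.exp (-1) := by
    by_contra! h
    apply hint
    rw [eq_top_iff]
    calc ⊤ = ∫⁻ _ in Set.Ioi x₀, ENNReal.ofReal (f x₀ * Real.exp (-1)) := by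
          rw [setLIntegral_const, Real.volume_Ioi, ENNReal.mul_top]
          simpa using mul_pos hx₀ (Real.exp_pos _)
      _ ≤ ∫⁻ x in Set.Ioi x₀, ENNReal.ofReal (f x) :=
          setLIntegral_mono' measurableSet_Ioi fun x hx => ENNReal.ofReal_le_ofReal (h x hx).le
      _ ≤ _ := setLIntegral_le_lintegral _ _
  have hM0 : 0 < M := hx₀.trans_le (hM x₀)
  refine ⟨x₁ - x₀, sub_pos.2 hx₁, fun z hz => ?_⟩
  have hd : 0 < x₁ - x₀ := sub_pos.2 hx₁
  rcases le_or_gt z x₁ with hz1 | hz1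
  · have : 0 ≤ 1 - (z - x₀) / (x₁ - x₀) := by
      rw [sub_nonneg, div_le_one hd]; linarith
    calc f z ≤ M * 1 := by rw [mul_one]; exact hM z
      _ ≤ _ := by gcongr; exact Real.one_le_exp this
  · have hzx : 0 < z - x₀ := by linarith
    set θ := (x₁ - x₀) / (z - x₀) with hθ
    have hθ0 : 0 < θ := by positivity
    have hθ1 : θ < 1 := by rw [hθ, div_lt_one hzx]; linarith
    have h := hf.2 x₀ z (1 - θ) θ (by linarith) hθ0 (by ring)
    have e : (1 - θ) * x₀ + θ * z = x₁ := by rw [hθ]; field_simp; ring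
    rw [e] at h
    have h2 : f z ^ θ ≤ (f x₀ * Real.exp (1 - 1 / θ)) ^ θ := by
      have h3 : f x₀ ^ (1 - θ) * f z ^ θ ≤ f x₀ ^ (1 - θ) * (f x₀ ^ θ * Real.exp (-1)) := by
        calc _ ≤ f x₀ * Real.exp (-1) := h.trans hfx₁
          _ = _ := by rw [← mul_assoc, ← Real.rpow_add hx₀]; simp
      have h4 := le_of_mul_le_mul_left h3 (Real.rpow_pos_of_pos hx₀ _)
      refine h4.trans ?_
      rw [Real.mul_rpow hx₀.le (Real.exp_pos _).le, ← Real.exp_mul]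
      have e2 : (1 - 1 / θ) * θ = θ - 1 := by field_simp
      rw [e2]
      have : Real.exp (-1) ≤ Real.exp (θ - 1) := Real.exp_le_exp.2 (by linarith)
      gcongr
    have h5 := (Real.rpow_le_rpow_iff (hf.1 z) (by positivity) hθ0).1 h2
    have e3 : 1 / θ = (z - x₀) / (x₁ - x₀) := by rw [hθ, one_div_div]
    rw [e3] at h5
    exact h5.trans (mul_le_mul_of_nonneg_right (hM x₀) (Real.exp_pos _).le)

theorem IsLogConcave.comp_neg (hf : IsLogConcave f) : IsLogConcave fun x => f (-x) := by
  refine ⟨fun x => hf.1 _, fun x y a c ha hc hac => ?_⟩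
  have := hf.2 (-x) (-y) a c ha hc hac
  rwa [show a * -x + c * -y = -(a * x + c * y) by ring] at this

/-- A log-concave density is bounded by a two-sided exponential. -/
theorem IsLogConcaveDensity.exists_le_exp_abs (hf : IsLogConcaveDensity f) :
    ∃ A c : ℝ, 0 < A ∧ 0 < c ∧ ∀ z, f z ≤ A * Real.exp (-(c * |z|)) := by
  obtain ⟨x₀, hx₀⟩ := hf.exists_pos
  set M := (supNorm f).toReal
  have hM := le_toReal_supNorm hf.supNorm_ne_top
  have hM0 : 0 < M := hx₀.trans_le (hM x₀)
  obtain ⟨d, hd, h1⟩ := hf.logConcave.exists_le_exp_right (by simp [hf.lintegral_eq_one]) hx₀ hM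
  obtain ⟨d', hd', h2⟩ := hf.logConcave.comp_neg.exists_le_exp_right (x₀ := -x₀) (M := M)
    (by
      rw [(Measure.measurePreserving_neg volume).lintegral_comp
        (f := fun x => ENNReal.ofReal (f x)) hf.measurable.ennreal_ofReal]
      simp [hf.lintegral_eq_one]) (by simpa) (fun x => hM _)
  refine ⟨M * Real.exp (1 + |x₀| / max d d'), 1 / max d d', by positivity, by positivity,
    fun z => ?_⟩
  have hD : 0 < max d d' := by positivity
  have key : f z ≤ M * Real.exp (1 - |z - x₀| / max d d') := by
    rcases le_total x₀ z with hz | hz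
    · rw [abs_of_nonneg (sub_nonneg.2 hz)]
      refine (h1 z hz).trans ?_
      have : 0 ≤ z - x₀ := sub_nonneg.2 hz
      gcongr
      exact le_max_left _ _
    · have h := h2 (-z) (by linarith)
      rw [neg_neg] at h
      rw [abs_of_nonpos (sub_nonpos.2 hz)]
      refine h.trans ?_
      have : 0 ≤ -(z - x₀) := by linarith
      rw [show -z - -x₀ = -(z - x₀) by ring]
      gcongr
      exact le_max_right _ _
  refine key.trans ?_
  rw [mul_assoc, ← Real.exp_add]
  gcongr
  have : |z| - |x₀| ≤ |z - x₀| := abs_sub_abs_le_abs_sub z x₀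
  have := div_le_div_of_nonneg_right this hD.le
  rw [sub_div] at this
  rw [one_div_mul_eq_div]
  linarith

end LogConcave

/-! ### Finiteness of the supremum over powers. -/

/-- Uniform bound on the normalised power integrals of a density with exponential tails. -/
theorem iSup_rpow_neg_mul_lintegral_rpow_lt_top {h : ℝ → ℝ} (h0 : ∀ y, 0 ≤ h y)
    (hint : ∫⁻ y, ENNReal.ofReal (h y) ≠ ⊤) {A c : ℝ} (hA : 0 < A) (hc : 0 < c)
    (hle : ∀ y, h y ≤ A * Real.exp (-(c * |y|))) (hsup : supNorm h ≠ ⊤) :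
    ⨆ (t : ℝ) (_ : 0 < t), (supNorm h + 1) ^ (-t) * ∫⁻ y, ENNReal.ofReal (t * h y ^ t) < ⊤ := by
  set N := (supNorm h).toReal with hN
  have hN0 : 0 ≤ N := ENNReal.toReal_nonneg
  have hB : supNorm h + 1 = ENNReal.ofReal (N + 1) := by
    rw [ENNReal.ofReal_add hN0 zero_le_one, hN, ENNReal.ofReal_toReal hsup, ENNReal.ofReal_one]
  set L := Real.log ((N + 1) / (N + 1 / 2)) with hL
  have hL0 : 0 < L := Real.log_pos (by rw [one_lt_div (by positivity)]; linarith)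
  refine lt_of_le_of_lt (b := max (ENNReal.ofReal (max A 1 * (2 / c)))
    (ENNReal.ofReal (1 / (L * (N + 1 / 2))) * ∫⁻ y, ENNReal.ofReal (h y))) ?_
    (max_lt ENNReal.ofReal_lt_top (ENNReal.mul_lt_top ENNReal.ofReal_lt_top hint.lt_top))
  refine iSup₂_le fun t ht => ?_
  -- For `t ≤ 1` the exponential tail integrates to a multiple of `1 / t`, cancelled by the factor
  -- `t`. For `t > 1` the bound `h ≤ N + 1/2`, positive and strictly below the base `N + 1`, gives
  -- geometric decay that beats `t`.
  rcases le_or_gt t 1 with ht1 | ht1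
  · refine le_max_of_le_left ?_
    have hone : (supNorm h + 1) ^ (-t) ≤ 1 :=
      ENNReal.rpow_le_one_of_one_le_of_neg le_add_self (by linarith)
    have hI : ∫ y : ℝ, Real.exp (-(c * t * |y|)) = 2 / (c * t) := by
      have := integral_comp_abs (f := fun y => Real.exp (-(c * t * y)))
      rw [this]
      simp_rw [← neg_mul]
      rw [integral_exp_mul_Ioi (by nlinarith [mul_pos hc ht])]
      simp
      field_simp
    -- A non-integrable function would have integral 0 by convention, contradicting the value just
    -- computed.
    have hIi : Integrable fun y : ℝ => Real.exp (-(c * t * |y|)) := by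
      by_contra hn
      rw [integral_undef hn] at hI
      have : 0 < 2 / (c * t) := by positivity
      linarith
    calc _ ≤ 1 * ∫⁻ y, ENNReal.ofReal (max A 1 * (t * Real.exp (-(c * t * |y|)))) := by
          refine mul_le_mul' hone (lintegral_mono fun y => ENNReal.ofReal_le_ofReal ?_)
          have h1 : h y ^ t ≤ (A * Real.exp (-(c * |y|))) ^ t :=
            Real.rpow_le_rpow (h0 y) (hle y) ht.le
          rw [Real.mul_rpow hA.le (Real.exp_pos _).le, ← Real.exp_mul] at h1
          have h2 : A ^ t ≤ max A 1 := by
            calc A ^ t ≤ (max A 1) ^ t := Real.rpow_le_rpow hA.le (le_max_left _ _) ht.le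
              _ ≤ (max A 1) ^ (1 : ℝ) := Real.rpow_le_rpow_of_exponent_le (le_max_right _ _) ht1
              _ = _ := Real.rpow_one _
          have e : -(c * |y|) * t = -(c * t * |y|) := by ring
          rw [e] at h1
          calc t * h y ^ t ≤ t * (max A 1 * Real.exp (-(c * t * |y|))) := by
                gcongr; exact h1.trans (by gcongr)
            _ = _ := by ring
      _ = ENNReal.ofReal (∫ y, max A 1 * (t * Real.exp (-(c * t * |y|)))) := by
          rw [one_mul, ofReal_integral_eq_lintegral_ofReal ((hIi.const_mul _).const_mul _)
            (Filter.Eventually.of_forall fun y => by positivity)]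
      _ ≤ _ := by
          rw [integral_const_mul, integral_const_mul, hI]
          apply le_of_eq
          congr 2
          field_simp
  · refine le_max_of_le_right ?_
    have hpos : 0 < N + 1 / 2 := by positivity
    have hpt (y : ℝ) : t * h y ^ t ≤ t * (N + 1 / 2) ^ (t - 1) * h y := by
      have hy := h0 y
      have hyN : h y ≤ N + 1 / 2 := (le_toReal_supNorm hsup y).trans (by linarith)
      rcases hy.eq_or_lt with hy0 | hy0
      · rw [← hy0, Real.zero_rpow (by linarith)]; simp
      · have : h y ^ t = h y ^ (t - 1) * h y := by
          rw [← Real.rpow_add_one hy0.ne']; simp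
        rw [this, mul_assoc]
        gcongr
    calc _ ≤ ENNReal.ofReal ((N + 1) ^ (-t)) *
            ∫⁻ y, ENNReal.ofReal (t * (N + 1 / 2) ^ (t - 1) * h y) := by
          rw [hB, ENNReal.ofReal_rpow_of_pos (by positivity)]
          exact mul_le_mul_right (lintegral_mono fun y => ENNReal.ofReal_le_ofReal (hpt y)) _
      _ = ENNReal.ofReal ((N + 1) ^ (-t) * (t * (N + 1 / 2) ^ (t - 1))) *
            ∫⁻ y, ENNReal.ofReal (h y) := by
          have hp : 0 ≤ t * (N + 1 / 2) ^ (t - 1) := by positivity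
          simp_rw [ENNReal.ofReal_mul hp]
          rw [lintegral_const_mul' _ _ ENNReal.ofReal_ne_top, ← mul_assoc,
            ← ENNReal.ofReal_mul (by positivity)]
      _ ≤ _ := by
          gcongr
          have e1 : (N + 1) ^ (-t) * (t * (N + 1 / 2) ^ (t - 1))
              = t * Real.exp (-(t * L)) / (N + 1 / 2) := by
            rw [hL, Real.log_div (by positivity) (by positivity),
              Real.rpow_def_of_pos (by positivity), Real.rpow_sub_one (by positivity),
              Real.rpow_def_of_pos (by positivity)]
            rw [show -(t * (Real.log (N + 1) - Real.log (N + 1 / 2)))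
              = Real.log (N + 1) * -t + Real.log (N + 1 / 2) * t by ring, Real.exp_add]
            ring
          rw [e1, ← div_div]
          gcongr
          rw [le_div_iff₀ hL0, Real.exp_neg, ← div_eq_mul_inv, div_mul_eq_mul_div,
            div_le_one (Real.exp_pos _)]
          linarith [Real.add_one_le_exp (t * L)]

/-! ### Gaussian linear forms and their independence over disjoint index sets. -/

instance : IsGaussian stdComplexGaussian := by
  have : (Complex.measurableEquivRealProd.symm : ℝ × ℝ → ℂ)
      = (Complex.equivRealProdCLM.symm : ℝ × ℝ → ℂ) := rfl
  rw [stdComplexGaussian, this]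
  infer_instance

/-- The law of `⟨x_t, b_t⟩` for `x_t` with i.i.d. `CN(0,1)` entries. -/
noncomputable def subInnerLaw {p : ℕ} (b : Fin p → ℂ) (t : Finset (Fin p)) : Measure ℂ :=
  (Measure.pi fun _ : t => stdComplexGaussian).map fun u => ∑ j : t, u j * star (b j)

/-- The density at `y` of `|w + v|² + z`, for `w` with law `ν` and `z` with density `f`. -/
noncomputable def phaselessDensity (f : ℝ → ℝ) (ν : Measure ℂ) (v : ℂ) (y : ℝ) : ℝ≥0∞ :=
  ∫⁻ w, ENNReal.ofReal (f (y - ‖w + v‖ ^ 2)) ∂ν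

section Law

variable {p : ℕ} (b : Fin p → ℂ)

instance isGaussian_subInnerLaw (t : Finset (Fin p)) : IsGaussian (subInnerLaw b t) := by
  have hind : iIndepFun (fun (i : t) (u : t → ℂ) => u i)
      (Measure.pi fun _ : t => stdComplexGaussian) :=
    iIndepFun_pi (X := fun _ x => x) fun _ => aemeasurable_id
  have hg := hind.hasGaussianLaw fun i =>
    ⟨by rw [(measurePreserving_eval (fun _ : t => stdComplexGaussian) i).map_eq]; infer_instance⟩
  have h1 : IsGaussian (Measure.pi fun _ : t => stdComplexGaussian) := by
    have := hg.isGaussian_map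
    rwa [show (fun (u : t → ℂ) (i : t) => u i) = id from rfl, Measure.map_id] at this
  let L : (t → ℂ) →L[ℝ] ℂ := ∑ j : t,
    ((ContinuousLinearMap.mul ℝ ℂ).flip (star (b j))).comp (ContinuousLinearMap.proj j)
  have hL : (fun u : t → ℂ => ∑ j : t, u j * star (b j)) = L := by
    ext u
    simp [L, mul_comm]
  rw [subInnerLaw, hL]
  infer_instance

@[fun_prop]
theorem measurable_subInner (t : Finset (Fin p)) : Measurable fun x => subInner t x b := by
  unfold subInner
  fun_prop

theorem map_subInner (t : Finset (Fin p)) :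
    (Measure.pi fun _ : Fin p => stdComplexGaussian).map (fun x => subInner t x b)
      = subInnerLaw b t := by
  have hind : iIndepFun (fun (i : Fin p) (u : Fin p → ℂ) => u i)
      (Measure.pi fun _ => stdComplexGaussian) :=
    iIndepFun_pi (X := fun _ x => x) fun _ => aemeasurable_id
  have h1 := (iIndepFun_iff_map_fun_eq_pi_map fun i => (measurable_pi_apply _).aemeasurable).1
    (hind.precomp (g := fun i : t => (i : Fin p)) Subtype.val_injective)
  have h2 (i : t) : (Measure.pi fun _ : Fin p => stdComplexGaussian).map (fun u => u i)
      = stdComplexGaussian :=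
    (measurePreserving_eval (fun _ : Fin p => stdComplexGaussian) (i : Fin p)).map_eq
  simp only [h2] at h1
  rw [subInnerLaw, ← h1, Measure.map_map (by fun_prop) (by fun_prop)]
  congr 1
  ext x
  simp only [subInner, Function.comp]
  exact (Finset.sum_coe_sort t fun j => x j * star (b j)).symm

theorem map_subInner_prod {t t' : Finset (Fin p)} (h : Disjoint t t') :
    (Measure.pi fun _ : Fin p => stdComplexGaussian).map
        (fun x => (subInner t x b, subInner t' x b))
      = (subInnerLaw b t).prod (subInnerLaw b t') := by
  have hind : iIndepFun (fun (i : Fin p) (u : Fin p → ℂ) => u i)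
      (Measure.pi fun _ => stdComplexGaussian) :=
    iIndepFun_pi (X := fun _ x => x) fun _ => aemeasurable_id
  have h1 := hind.indepFun_finset t t' h fun i => measurable_pi_apply i
  have h2 := h1.comp (φ := fun u => ∑ j : t, u j * star (b j))
    (ψ := fun u => ∑ j : t', u j * star (b j)) (by fun_prop) (by fun_prop)
  have e (t : Finset (Fin p)) : ((fun u : t → ℂ => ∑ j : t, u j * star (b j)) ∘
      fun (a : Fin p → ℂ) (i : t) => a i) = fun x => subInner t x b := by
    ext x
    exact Finset.sum_coe_sort t fun j => x j * star (b j)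
  rw [e, e] at h2
  rw [h2.map_prod_eq_prod_map_map (by fun_prop) (by fun_prop), map_subInner, map_subInner]

theorem subInner_union {s sdif seq : Finset (Fin p)} (hdisj : Disjoint sdif seq)
    (hunion : sdif ∪ seq = s) (x : Fin p → ℂ) :
    subInner sdif x b + subInner seq x b = subInner s x b := by
  rw [← hunion]
  exact (Finset.sum_union hdisj).symm

theorem map_add_subInnerLaw {s sdif seq : Finset (Fin p)} (hdisj : Disjoint sdif seq)
    (hunion : sdif ∪ seq = s) :
    ((subInnerLaw b sdif).prod (subInnerLaw b seq)).map (fun q => q.1 + q.2)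
      = subInnerLaw b s := by
  rw [← map_subInner_prod b hdisj, Measure.map_map (by fun_prop) (by fun_prop),
    ← map_subInner b s]
  congr 1
  ext x
  exact subInner_union b hdisj hunion x

end Law

/-- At `a = 0` this reads `0 * ∞ = 0`, so zeros of the densities need no separate treatment below.
-/
theorem ENNReal.mul_rpow_neg_half_eq {a : ℝ≥0∞} (ha : a ≠ ⊤) :
    a * a ^ (-(1 / 2) : ℝ) = a ^ (1 / 2 : ℝ) := by
  rcases eq_or_ne a 0 with rfl | h0
  · simp
  · nth_rewrite 1 [← ENNReal.rpow_one a]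
    rw [← ENNReal.rpow_add _ _ h0 ha]
    norm_num

/-! ### Density of the phaseless observation. -/

section PhaselessDensity

variable {f : ℝ → ℝ} {ν : Measure ℂ}

theorem measurable_phaselessDensity (hf : Measurable f) [SFinite ν] :
    Measurable fun q : ℂ × ℝ => phaselessDensity f ν q.1 q.2 := by
  unfold phaselessDensity
  exact Measurable.lintegral_prod_right' (ν := ν)
    (f := fun r : (ℂ × ℝ) × ℂ => ENNReal.ofReal (f (r.1.2 - ‖r.2 + r.1.1‖ ^ 2))) (by fun_prop)

theorem phaselessDensity_le_supNorm [IsProbabilityMeasure ν] (v : ℂ) (y : ℝ) :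
    phaselessDensity f ν v y ≤ supNorm f :=
  (lintegral_mono fun _ => ofReal_le_supNorm f _).trans (by simp)

theorem lintegral_sqrt_le_sqrt_lintegral {α : Type*} [MeasurableSpace α] (ρ : Measure α)
    [IsProbabilityMeasure ρ] {g : α → ℝ≥0∞} (hg : Measurable g) :
    ∫⁻ x, g x ^ (1 / 2 : ℝ) ∂ρ ≤ (∫⁻ x, g x ∂ρ) ^ (1 / 2 : ℝ) := by
  have h := ENNReal.lintegral_mul_le_Lp_mul_Lq ρ Real.HolderConjugate.two_two
    (f := fun x => g x ^ (1 / 2 : ℝ)) (g := fun _ => 1) (by fun_prop) (by fun_prop)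
  have e (x : α) : (g x ^ (1 / 2 : ℝ)) ^ (2 : ℝ) = g x := by
    rw [← ENNReal.rpow_mul]
    norm_num
  simp only [e] at h
  simpa using h

/-- Half-power moment of the conditional density of the observation, bounded by Jensen's
inequality in terms of the marginal density. -/
theorem lintegral_phaselessDensity_rpow_neg_half_le (hf : Measurable f)
    (hsup : supNorm f ≠ ⊤) (ν₁ ν₂ : Measure ℂ) [IsProbabilityMeasure ν₁]
    [IsProbabilityMeasure ν₂] :
    ∫⁻ q, (∫⁻ z, ENNReal.ofReal (f z) *
        phaselessDensity f ν₁ q.2 (‖q.1 + q.2‖ ^ 2 + z) ^ (-(1 / 2) : ℝ)) ∂(ν₁.prod ν₂)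
      ≤ ∫⁻ y, phaselessDensity f ((ν₁.prod ν₂).map fun q => q.1 + q.2) 0 y ^ (1 / 2 : ℝ) := by
  have hm := measurable_phaselessDensity (ν := ν₁) hf
  have hm' {α : Type} [MeasurableSpace α] {g : α → ℂ} {h : α → ℝ} (hg : Measurable g)
      (hh : Measurable h) : Measurable fun a => phaselessDensity f ν₁ (g a) (h a) :=
    hm.comp (hg.prodMk hh)
  have shift (q : ℂ × ℂ) : ∫⁻ z, ENNReal.ofReal (f z) *
        phaselessDensity f ν₁ q.2 (‖q.1 + q.2‖ ^ 2 + z) ^ (-(1 / 2) : ℝ)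
      = ∫⁻ y, ENNReal.ofReal (f (y - ‖q.1 + q.2‖ ^ 2)) *
        phaselessDensity f ν₁ q.2 y ^ (-(1 / 2) : ℝ) := by
    rw [← lintegral_add_left_eq_self (μ := volume) (fun y =>
      ENNReal.ofReal (f (y - ‖q.1 + q.2‖ ^ 2)) * phaselessDensity f ν₁ q.2 y ^ (-(1 / 2) : ℝ))
      (‖q.1 + q.2‖ ^ 2)]
    simp
  have hmint : Measurable fun r : (ℂ × ℂ) × ℝ => ENNReal.ofReal (f (r.2 - ‖r.1.1 + r.1.2‖ ^ 2)) *
      phaselessDensity f ν₁ r.1.2 r.2 ^ (-(1 / 2) : ℝ) := by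
    have := hm' (α := (ℂ × ℂ) × ℝ) (g := fun r => r.1.2) (h := fun r => r.2) (by fun_prop)
      (by fun_prop)
    fun_prop
  simp_rw [shift]
  rw [lintegral_lintegral_swap hmint.aemeasurable]
  refine lintegral_mono fun y => ?_
  have hmy : Measurable fun q : ℂ × ℂ => ENNReal.ofReal (f (y - ‖q.1 + q.2‖ ^ 2)) *
      phaselessDensity f ν₁ q.2 y ^ (-(1 / 2) : ℝ) :=
    hmint.comp (measurable_id.prodMk measurable_const)
  have hmv : Measurable fun v : ℂ => phaselessDensity f ν₁ v y :=
    hm' measurable_id measurable_const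
  calc ∫⁻ q, ENNReal.ofReal (f (y - ‖q.1 + q.2‖ ^ 2)) *
          phaselessDensity f ν₁ q.2 y ^ (-(1 / 2) : ℝ) ∂(ν₁.prod ν₂)
      = ∫⁻ v, ∫⁻ w, ENNReal.ofReal (f (y - ‖w + v‖ ^ 2)) *
          phaselessDensity f ν₁ v y ^ (-(1 / 2) : ℝ) ∂ν₁ ∂ν₂ :=
        lintegral_prod_symm _ hmy.aemeasurable
    -- The power factor does not depend on `w`, and the `w`-integral of the other factor is the
    -- conditional density itself.
    _ = ∫⁻ v, phaselessDensity f ν₁ v y ^ (1 / 2 : ℝ) ∂ν₂ := by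
        refine lintegral_congr fun v => ?_
        rw [lintegral_mul_const _ (by fun_prop)]
        exact ENNReal.mul_rpow_neg_half_eq (ne_top_of_le_ne_top hsup (phaselessDensity_le_supNorm v y))
    _ ≤ (∫⁻ v, phaselessDensity f ν₁ v y ∂ν₂) ^ (1 / 2 : ℝ) :=
        lintegral_sqrt_le_sqrt_lintegral ν₂ hmv
    _ = _ := by
        rw [phaselessDensity, lintegral_map (by fun_prop) (by fun_prop),
          lintegral_prod_symm _ (by fun_prop)]
        simp [phaselessDensity]

theorem lintegral_phaselessDensity (hf : IsLogConcaveDensity f) [IsProbabilityMeasure ν] (v : ℂ) :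
    ∫⁻ y, phaselessDensity f ν v y = 1 := by
  have := hf.measurable
  unfold phaselessDensity
  rw [lintegral_lintegral_swap (by fun_prop)]
  simp_rw [lintegral_sub_right_eq_self (fun y => ENNReal.ofReal (f y)), hf.lintegral_eq_one]
  simp

theorem phaselessDensity_ne_top (hf : IsLogConcaveDensity f) [IsProbabilityMeasure ν] (v : ℂ)
    (y : ℝ) : phaselessDensity f ν v y ≠ ⊤ :=
  ne_top_of_le_ne_top hf.supNorm_ne_top (phaselessDensity_le_supNorm v y)

theorem IsLogConcaveDensity.integrable_comp (hf : IsLogConcaveDensity f) {α : Type*}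
    [MeasurableSpace α] {ρ : Measure α} [IsProbabilityMeasure ρ] {g : α → ℝ} (hg : Measurable g) :
    Integrable (fun x => f (g x)) ρ :=
  Integrable.of_bound (hf.measurable.comp hg).aestronglyMeasurable (supNorm f).toReal
    (Filter.Eventually.of_forall fun x => by
      rw [Real.norm_of_nonneg (hf.logConcave.1 _)]
      exact le_toReal_supNorm hf.supNorm_ne_top _)

/-- The density of the phaseless observation has exponential tails. -/
theorem IsLogConcaveDensity.exists_integral_phaseless_le (hf : IsLogConcaveDensity f)
    [IsGaussian ν] : ∃ A c : ℝ, 0 < A ∧ 0 < c ∧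
      ∀ y, ∫ w, f (y - ‖w‖ ^ 2) ∂ν ≤ A * Real.exp (-(c * |y|)) := by
  obtain ⟨A, c, hA, hc, hle⟩ := hf.exists_le_exp_abs
  obtain ⟨c', hc', hint⟩ := IsGaussian.exists_integrable_exp_sq ν
  set I := ∫ w, Real.exp (c' * ‖w‖ ^ 2) ∂ν
  have hI : 0 ≤ I := integral_nonneg fun w => (Real.exp_pos _).le
  refine ⟨A * (I + 1), min c c', by positivity, by positivity, fun y => ?_⟩
  -- From `|y| ≤ |y - ‖w‖²| + ‖w‖²`, decay in `y` costs only a factor `exp (c' ‖w‖²)`, integrable by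
  -- Fernique's theorem.
  have hpt (w : ℂ) : f (y - ‖w‖ ^ 2) ≤
      A * Real.exp (-(min c c' * |y|)) * Real.exp (c' * ‖w‖ ^ 2) := by
    refine (hle _).trans ?_
    rw [mul_assoc, ← Real.exp_add]
    gcongr
    have h1 : |y| - ‖w‖ ^ 2 ≤ |y - ‖w‖ ^ 2| := by
      have := abs_sub_abs_le_abs_sub y (‖w‖ ^ 2)
      rwa [abs_of_nonneg (sq_nonneg ‖w‖)] at this
    have hmin : 0 ≤ min c c' := by positivity
    have h2 := mul_le_mul_of_nonneg_left h1 hmin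
    have h3 := mul_le_mul_of_nonneg_right (min_le_left c c') (abs_nonneg (y - ‖w‖ ^ 2))
    have h4 := mul_le_mul_of_nonneg_right (min_le_right c c') (sq_nonneg ‖w‖)
    linarith
  calc ∫ w, f (y - ‖w‖ ^ 2) ∂ν
      ≤ ∫ w, A * Real.exp (-(min c c' * |y|)) * Real.exp (c' * ‖w‖ ^ 2) ∂ν :=
        integral_mono (hf.integrable_comp (by fun_prop)) (hint.const_mul _) hpt
    _ = A * Real.exp (-(min c c' * |y|)) * I := integral_const_mul _ _
    _ ≤ A * Real.exp (-(min c c' * |y|)) * (I + 1) := by gcongr; linarith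
    _ = _ := by ring

end PhaselessDensity

/-- As `a` and `g` are at most `M`, `|log a - log g|` is at most the larger of `log (M / a)` and
`log (M / g)`. If `a` or `g` vanishes, the right side is infinite. -/
theorem ofReal_exp_abs_log_div_le {a g : ℝ} (ha : 0 ≤ a) (hg : 0 ≤ g) {M : ℝ≥0∞} (hM0 : M ≠ 0)
    (hM : M ≠ ⊤) (haM : ENNReal.ofReal a ≤ M) (hgM : ENNReal.ofReal g ≤ M) :
    ENNReal.ofReal (Real.exp (|Real.log (a / g)| / 2))
      ≤ M ^ (1 / 2 : ℝ) * ENNReal.ofReal a ^ (-(1 / 2) : ℝ)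
        + M ^ (1 / 2 : ℝ) * ENNReal.ofReal g ^ (-(1 / 2) : ℝ) := by
  have hMh : M ^ (1 / 2 : ℝ) ≠ 0 := by simp [ENNReal.rpow_eq_zero_iff, hM0]
  rcases ha.eq_or_lt with rfl | ha
  · rw [ENNReal.ofReal_zero, ENNReal.zero_rpow_of_neg (by norm_num), ENNReal.mul_top hMh]
    simp
  rcases hg.eq_or_lt with rfl | hg
  · rw [ENNReal.ofReal_zero, ENNReal.zero_rpow_of_neg (by norm_num), ENNReal.mul_top hMh]
    simp
  rw [ENNReal.ofReal_le_iff_le_toReal hM] at haM hgM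
  obtain ⟨m, rfl⟩ : ∃ m, M = ENNReal.ofReal m := ⟨M.toReal, (ENNReal.ofReal_toReal hM).symm⟩
  have hm : 0 < m := by
    by_contra! h
    exact hM0 (ENNReal.ofReal_of_nonpos h)
  rw [ENNReal.toReal_ofReal hm.le] at haM hgM
  have key {u : ℝ} (hu : 0 < u) : ENNReal.ofReal m ^ (1 / 2 : ℝ) *
      ENNReal.ofReal u ^ (-(1 / 2) : ℝ)
        = ENNReal.ofReal (Real.exp ((Real.log m - Real.log u) / 2)) := by
    rw [ENNReal.ofReal_rpow_of_pos hm, ENNReal.ofReal_rpow_of_pos hu,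
      ← ENNReal.ofReal_mul (by positivity), Real.rpow_def_of_pos hm, Real.rpow_def_of_pos hu,
      ← Real.exp_add]
    ring_nf
  rw [key ha, key hg, Real.log_div ha.ne' hg.ne']
  have hla := Real.log_le_log ha haM
  have hlg := Real.log_le_log hg hgM
  rcases le_total (Real.log a) (Real.log g) with h | h
  · refine le_add_of_le_of_nonneg (ENNReal.ofReal_le_ofReal (Real.exp_le_exp.2 ?_)) zero_le
    rw [abs_of_nonpos (by linarith)]
    linarith
  · refine le_add_of_nonneg_of_le zero_le (ENNReal.ofReal_le_ofReal (Real.exp_le_exp.2 ?_))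
    rw [abs_of_nonneg (by linarith)]
    linarith

/-! ### Exponential moment of the information density. -/

section Model

variable {p : ℕ} {fZ : ℝ → ℝ} (hfZ : IsLogConcaveDensity fZ) (b : Fin p → ℂ)
include hfZ

theorem IsLogConcaveDensity.isProbabilityMeasure_noiseLaw : IsProbabilityMeasure (noiseLaw fZ) :=
  ⟨by rw [noiseLaw, withDensity_apply _ .univ, Measure.restrict_univ, hfZ.lintegral_eq_one]⟩

theorem ofReal_integral_pi_eq_phaselessDensity (t : Finset (Fin p)) (v : ℂ) (y : ℝ) :
    ENNReal.ofReal (∫ u : t → ℂ, fZ (y - ‖∑ j : t, u j * star (b j) + v‖ ^ 2)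
      ∂(Measure.pi fun _ : t => stdComplexGaussian)) = phaselessDensity fZ (subInnerLaw b t) v y := by
  have hm := hfZ.measurable
  rw [ofReal_integral_eq_lintegral_ofReal (hfZ.integrable_comp (by fun_prop))
    (Filter.Eventually.of_forall fun _ => hfZ.logConcave.1 _), phaselessDensity, subInnerLaw,
    lintegral_map (by fun_prop) (by fun_prop)]

theorem densityEq_eq_toReal (sdif seq : Finset (Fin p)) (x : Fin p → ℂ) (y : ℝ) :
    densityEq fZ b sdif seq x y
      = (phaselessDensity fZ (subInnerLaw b sdif) (subInner seq x b) y).toReal := by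
  rw [← ofReal_integral_pi_eq_phaselessDensity hfZ, ENNReal.toReal_ofReal
    (integral_nonneg fun _ => hfZ.logConcave.1 _), densityEq]

theorem ofReal_densityMarginal (s : Finset (Fin p)) (y : ℝ) :
    ENNReal.ofReal (densityMarginal fZ b s y) = phaselessDensity fZ (subInnerLaw b s) 0 y := by
  rw [← ofReal_integral_pi_eq_phaselessDensity hfZ, densityMarginal]
  simp

theorem densityMarginal_nonneg (s : Finset (Fin p)) (y : ℝ) : 0 ≤ densityMarginal fZ b s y :=
  integral_nonneg fun _ => hfZ.logConcave.1 _

theorem supNorm_densityMarginal_le (s : Finset (Fin p)) :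
    supNorm (densityMarginal fZ b s) ≤ supNorm fZ := by
  refine iSup_le fun y => ?_
  rw [ofReal_densityMarginal hfZ]
  exact phaselessDensity_le_supNorm _ _

theorem constD_ne_top (s : Finset (Fin p)) : constD fZ b s ≠ ⊤ := by
  obtain ⟨A, c, hA, hc, hle⟩ := hfZ.exists_integral_phaseless_le (ν := subInnerLaw b s)
  have hm := hfZ.measurable
  refine (iSup_rpow_neg_mul_lintegral_rpow_lt_top (densityMarginal_nonneg hfZ b s) ?_ hA hc
    (fun y => ?_) (ne_top_of_le_ne_top hfZ.supNorm_ne_top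
      (supNorm_densityMarginal_le hfZ b s))).ne
  · simp_rw [ofReal_densityMarginal hfZ, lintegral_phaselessDensity hfZ]
    simp
  · refine le_of_eq_of_le ?_ (hle y)
    rw [subInnerLaw, integral_map (φ := fun u : s → ℂ => ∑ j : s, u j * star (b j))
      (by exact Measurable.aemeasurable (by fun_prop))
      (by exact (hm.comp (by fun_prop)).aestronglyMeasurable)]
    rfl

theorem constC_ne_top (s : Finset (Fin p)) : constC fZ b s ≠ ⊤ := by
  refine ENNReal.mul_ne_top (by simp) (max_lt ?_ (by simp)).ne
  exact ENNReal.mul_lt_top (ENNReal.mul_lt_top (by simp) (constD_ne_top hfZ b s).lt_top)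
    (ENNReal.add_lt_top.2 ⟨hfZ.supNorm_ne_top.lt_top, by simp⟩)

/-- This is the term `t = 1/2` of the supremum defining `D`, with its normalisation cleared; the 2
is `1 / t`. -/
theorem lintegral_densityMarginal_rpow_half_le (s : Finset (Fin p)) :
    ∫⁻ y, ENNReal.ofReal (densityMarginal fZ b s y) ^ (1 / 2 : ℝ)
      ≤ 2 * constD fZ b s * (supNorm fZ + 1) ^ (1 / 2 : ℝ) := by
  set N := supNorm (densityMarginal fZ b s) with hN
  have hNtop : N + 1 ≠ ⊤ := by
    simpa using ne_top_of_le_ne_top hfZ.supNorm_ne_top (supNorm_densityMarginal_le hfZ b s)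
  have hN0 : N + 1 ≠ 0 := by simp
  have h0 := densityMarginal_nonneg hfZ b s
  have hD : (N + 1) ^ (-(1 / 2) : ℝ) *
      ∫⁻ y, ENNReal.ofReal (1 / 2 * densityMarginal fZ b s y ^ (1 / 2 : ℝ)) ≤ constD fZ b s :=
    le_iSup₂ (f := fun (t : ℝ) (_ : 0 < t) => (N + 1) ^ (-t) *
      ∫⁻ y, ENNReal.ofReal (t * densityMarginal fZ b s y ^ t)) (1 / 2 : ℝ) (by norm_num)
  have hhalf (y : ℝ) : ENNReal.ofReal (densityMarginal fZ b s y) ^ (1 / 2 : ℝ)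
      = 2 * ENNReal.ofReal (1 / 2 * densityMarginal fZ b s y ^ (1 / 2 : ℝ)) := by
    rw [ENNReal.ofReal_rpow_of_nonneg (h0 y) (by norm_num), ← ENNReal.ofReal_ofNat 2,
      ← ENNReal.ofReal_mul (by norm_num)]
    ring_nf
  simp_rw [hhalf]
  rw [lintegral_const_mul' _ _ (by simp), mul_assoc]
  gcongr
  calc ∫⁻ y, ENNReal.ofReal (1 / 2 * densityMarginal fZ b s y ^ (1 / 2 : ℝ))
      = (N + 1) ^ (1 / 2 : ℝ) * ((N + 1) ^ (-(1 / 2) : ℝ) *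
        ∫⁻ y, ENNReal.ofReal (1 / 2 * densityMarginal fZ b s y ^ (1 / 2 : ℝ))) := by
        rw [← mul_assoc, ← ENNReal.rpow_add _ _ hN0 hNtop]
        simp
    _ ≤ (supNorm fZ + 1) ^ (1 / 2 : ℝ) * constD fZ b s := by
        refine mul_le_mul' (ENNReal.rpow_le_rpow ?_ (by norm_num)) hD
        exact add_le_add_left (supNorm_densityMarginal_le hfZ b s) 1
    _ = _ := mul_comm _ _

variable {s sdif seq : Finset (Fin p)}

/-- Subtracting the noiseless part leaves `fZ` at the noise alone, and the denominator sees the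
measurement only through two independent inner products. -/
theorem infoDensityOfNoise_eq (hdisj : Disjoint sdif seq) (hunion : sdif ∪ seq = s)
    (q : (Fin p → ℂ) × ℝ) :
    infoDensityOfNoise fZ b s sdif seq q = Real.log (fZ q.2 /
      (phaselessDensity fZ (subInnerLaw b sdif) (subInner seq q.1 b)
        (‖subInner sdif q.1 b + subInner seq q.1 b‖ ^ 2 + q.2)).toReal) := by
  rw [infoDensityOfNoise, infoDensity, densityEq_eq_toReal hfZ, densityFull, phaseless,
    subInner_union b hdisj hunion]
  simp

theorem lintegral_singleLaw {h : (Fin p → ℂ) × ℝ → ℝ≥0∞} (hh : Measurable h) :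
    ∫⁻ q, h q ∂(singleLaw p fZ) = ∫⁻ x, (∫⁻ z, ENNReal.ofReal (fZ z) * h (x, z))
      ∂(Measure.pi fun _ => stdComplexGaussian) := by
  have := hfZ.isProbabilityMeasure_noiseLaw
  rw [singleLaw, lintegral_prod _ hh.aemeasurable]
  refine lintegral_congr fun x => ?_
  rw [noiseLaw, lintegral_withDensity_eq_lintegral_mul _ hfZ.measurable.ennreal_ofReal
    (g := fun z => h (x, z)) (hh.comp measurable_prodMk_left)]
  rfl

theorem lintegral_singleLaw_noise_le :
    ∫⁻ q, supNorm fZ ^ (1 / 2 : ℝ) * ENNReal.ofReal (fZ q.2) ^ (-(1 / 2) : ℝ) ∂(singleLaw p fZ)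
      ≤ 2 := by
  have hm := hfZ.measurable
  have hMh : supNorm fZ ^ (1 / 2 : ℝ) ≠ ⊤ := by
    simp [ENNReal.rpow_eq_top_iff, hfZ.supNorm_ne_top]
  rw [lintegral_const_mul' _ _ hMh, lintegral_singleLaw hfZ (by fun_prop)]
  simp only [lintegral_const, measure_univ, mul_one]
  refine le_trans (le_of_eq ?_) hfZ.supNorm_rpow_half_mul_lintegral_le
  congr 1
  exact lintegral_congr fun z => ENNReal.mul_rpow_neg_half_eq ENNReal.ofReal_ne_top

theorem measurable_phaselessDensity_add (ν : Measure ℂ) [SFinite ν] :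
    Measurable fun r : (ℂ × ℂ) × ℝ =>
      phaselessDensity fZ ν r.1.2 (‖r.1.1 + r.1.2‖ ^ 2 + r.2) :=
  (measurable_phaselessDensity hfZ.measurable).comp
    (g := fun q : ℂ × ℝ => phaselessDensity fZ ν q.1 q.2)
    (f := fun r : (ℂ × ℂ) × ℝ => (r.1.2, ‖r.1.1 + r.1.2‖ ^ 2 + r.2)) (by fun_prop)

theorem measurable_phaselessDensity_subInner (sdif seq : Finset (Fin p)) :
    Measurable fun q : (Fin p → ℂ) × ℝ =>
      phaselessDensity fZ (subInnerLaw b sdif) (subInner seq q.1 b)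
        (‖subInner sdif q.1 b + subInner seq q.1 b‖ ^ 2 + q.2) :=
  (measurable_phaselessDensity_add hfZ (subInnerLaw b sdif)).comp
    (f := fun q : (Fin p → ℂ) × ℝ => ((subInner sdif q.1 b, subInner seq q.1 b), q.2))
    (by fun_prop)

theorem lintegral_singleLaw_observation_le (hdisj : Disjoint sdif seq)
    (hunion : sdif ∪ seq = s) :
    ∫⁻ q, supNorm fZ ^ (1 / 2 : ℝ) * phaselessDensity fZ (subInnerLaw b sdif) (subInner seq q.1 b)
        (‖subInner sdif q.1 b + subInner seq q.1 b‖ ^ 2 + q.2) ^ (-(1 / 2) : ℝ) ∂(singleLaw p fZ)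
      ≤ 2 * constD fZ b s * (supNorm fZ + 1) := by
  have hm := hfZ.measurable
  have hMh : supNorm fZ ^ (1 / 2 : ℝ) ≠ ⊤ := by
    simp [ENNReal.rpow_eq_top_iff, hfZ.supNorm_ne_top]
  have hG := measurable_phaselessDensity_add hfZ (subInnerLaw b sdif)
  have hF : Measurable fun r : ℂ × ℂ => ∫⁻ z, ENNReal.ofReal (fZ z) *
      phaselessDensity fZ (subInnerLaw b sdif) r.2 (‖r.1 + r.2‖ ^ 2 + z) ^ (-(1 / 2) : ℝ) :=
    Measurable.lintegral_prod_right' (f := fun a : (ℂ × ℂ) × ℝ => ENNReal.ofReal (fZ a.2) *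
      phaselessDensity fZ (subInnerLaw b sdif) a.1.2 (‖a.1.1 + a.1.2‖ ^ 2 + a.2)
        ^ (-(1 / 2) : ℝ))
      ((hm.comp measurable_snd).ennreal_ofReal.mul (hG.pow_const _))
  rw [lintegral_const_mul' _ _ hMh, lintegral_singleLaw hfZ
    ((measurable_phaselessDensity_subInner hfZ b sdif seq).pow_const _)]
  have h1 := lintegral_phaselessDensity_rpow_neg_half_le hm hfZ.supNorm_ne_top
    (subInnerLaw b sdif) (subInnerLaw b seq)
  rw [map_add_subInnerLaw b hdisj hunion, ← map_subInner_prod b hdisj,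
    lintegral_map hF (by fun_prop)] at h1
  simp_rw [← ofReal_densityMarginal hfZ] at h1
  calc _ ≤ (supNorm fZ + 1) ^ (1 / 2 : ℝ) *
          (2 * constD fZ b s * (supNorm fZ + 1) ^ (1 / 2 : ℝ)) :=
        mul_le_mul' (ENNReal.rpow_le_rpow le_self_add (by norm_num))
          (h1.trans (lintegral_densityMarginal_rpow_half_le hfZ b s))
    _ = 2 * constD fZ b s * ((supNorm fZ + 1) ^ (1 / 2 : ℝ) * (supNorm fZ + 1) ^ (1 / 2 : ℝ)) := by
        ring
    _ = _ := by
        rw [← ENNReal.rpow_add _ _ (by simp) (by simpa using hfZ.supNorm_ne_top)]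
        norm_num

theorem measurable_infoDensityOfNoise (hdisj : Disjoint sdif seq) (hunion : sdif ∪ seq = s) :
    Measurable (infoDensityOfNoise fZ b s sdif seq) := by
  have hm := hfZ.measurable
  have hg := measurable_phaselessDensity_subInner hfZ b sdif seq
  rw [funext (infoDensityOfNoise_eq hfZ b hdisj hunion)]
  fun_prop

/-- Exponential moment of the information density. -/
theorem lintegral_exp_abs_infoDensityOfNoise_le (hdisj : Disjoint sdif seq)
    (hunion : sdif ∪ seq = s) :
    ∫⁻ q, ENNReal.ofReal (Real.exp (|infoDensityOfNoise fZ b s sdif seq q| / 2)) ∂(singleLaw p fZ)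
      ≤ 2 + 2 * constD fZ b s * (supNorm fZ + 1) := by
  have hm := hfZ.measurable
  refine le_trans ?_ (add_le_add (lintegral_singleLaw_noise_le (p := p) hfZ)
    (lintegral_singleLaw_observation_le hfZ b hdisj hunion))
  rw [← lintegral_add_left (by fun_prop)]
  refine lintegral_mono fun q => ?_
  rw [infoDensityOfNoise_eq hfZ b hdisj hunion]
  set G := phaselessDensity fZ (subInnerLaw b sdif) (subInner seq q.1 b)
    (‖subInner sdif q.1 b + subInner seq q.1 b‖ ^ 2 + q.2)
  have hG : ENNReal.ofReal G.toReal = G :=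
    ENNReal.ofReal_toReal (phaselessDensity_ne_top hfZ _ _)
  have h := ofReal_exp_abs_log_div_le (hfZ.logConcave.1 q.2)
    (ENNReal.toReal_nonneg (a := G)) hfZ.supNorm_ne_zero hfZ.supNorm_ne_top
    (ofReal_le_supNorm fZ q.2) (by rw [hG]; exact phaselessDensity_le_supNorm _ _)
  rwa [hG] at h

end Model

/-! ### Assembly of the two tail bounds. -/

theorem ofReal_exp_le_tailBound {n : ℕ} {C μ : ℝ} (hμ : 0 < μ) :
    ENNReal.ofReal (Real.exp (-(n * C * (μ - Real.log (1 + μ))))) ≤ tailBound n C μ := by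
  -- The `r(μ)` term alone suffices; the `r(-μ)` term is dropped as nonnegative.
  refine le_trans (le_of_eq ?_) le_self_add
  rw [rateFun, if_pos (by linarith), ← EReal.coe_mul, ← EReal.coe_neg, EReal.exp_coe]

theorem theorem4 {Ω : Type*} [MeasurableSpace Ω] (P : Measure Ω) [IsProbabilityMeasure P]
    (n p : ℕ) (fZ : ℝ → ℝ) (hfZ : IsLogConcaveDensity fZ)
    (s sdif seq : Finset (Fin p)) (hdif : sdif.Nonempty) (hdisj : Disjoint sdif seq)
    (hunion : sdif ∪ seq = s) (b : Fin p → ℂ)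
    (X : Ω → Fin n → Fin p → ℂ) (Z Y : Ω → Fin n → ℝ)
    (hXZ : HasLaw (fun ω => (X ω, Z ω)) (designNoiseLaw n p fZ) P)
    (hY : ∀ ω i, Y ω i = phaseless s b (X ω i) + Z ω i) :
    constC fZ b s ≠ ⊤ ∧
    Integrable (infoDensityOfNoise fZ b s sdif seq) (singleLaw p fZ) ∧
    ∀ μ : ℝ, 0 < μ →
      P {ω | infoDensityN fZ b sdif seq (X ω) (Y ω) - n * condMutualInfo fZ b s sdif seq
          ≤ -(2 * n * (constC fZ b s).toReal * μ)} ≤ tailBound n (constC fZ b s).toReal μ ∧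
      P {ω | 2 * n * (constC fZ b s).toReal * μ
          ≤ infoDensityN fZ b sdif seq (X ω) (Y ω) - n * condMutualInfo fZ b s sdif seq}
        ≤ tailBound n (constC fZ b s).toReal μ := by
  have := hfZ.isProbabilityMeasure_noiseLaw
  have : IsProbabilityMeasure (singleLaw p fZ) := by unfold singleLaw; infer_instance
  have hC := constC_ne_top hfZ b s
  have hUm := measurable_infoDensityOfNoise hfZ b hdisj hunion
  set U := infoDensityOfNoise fZ b s sdif seq with hU
  set κ := (2 + 2 * constD fZ b s * (supNorm fZ + 1)).toReal with hκ
  have hκtop : 2 + 2 * constD fZ b s * (supNorm fZ + 1) ≠ ⊤ :=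
    ENNReal.add_ne_top.2 ⟨by simp, ENNReal.mul_ne_top (ENNReal.mul_ne_top (by simp)
      (constD_ne_top hfZ b s)) (by simpa using hfZ.supNorm_ne_top)⟩
  have hexp : ∫⁻ q, ENNReal.ofReal (Real.exp (|U q| / 2)) ∂(singleLaw p fZ)
      ≤ ENNReal.ofReal κ := by
    rw [hκ, ENNReal.ofReal_toReal hκtop]
    exact lintegral_exp_abs_infoDensityOfNoise_le hfZ b hdisj hunion
  have hκC : 2 * κ ≤ (constC fZ b s).toReal := by
    rw [hκ, ← ENNReal.toReal_ofNat 2, ← ENNReal.toReal_mul]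
    refine ENNReal.toReal_mono hC ?_
    set K := 2 * constD fZ b s * (supNorm fZ + 1)
    rw [constC]
    -- The constant 6 is enough here; 150 leaves slack.
    calc 2 * (2 + K) = 4 * 1 + 2 * K := by ring
      _ ≤ 4 * max K 1 + 2 * max K 1 := by gcongr <;> simp
      _ = 6 * max K 1 := by ring
      _ ≤ 150 * max K 1 := by gcongr; norm_num
  refine ⟨hC, integrable_of_lintegral_exp_abs_le hUm hexp, fun μ hμ => ?_⟩
  have hinfo (ω : Ω) : infoDensityN fZ b sdif seq (X ω) (Y ω)
      = ∑ i, U (X ω i, Z ω i) :=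
    Finset.sum_congr rfl fun i _ => by rw [hY ω i]; rfl
  -- Stated for a general `V` so that it serves both `U` and `-U`. The matrix and the noise vector
  -- are regrouped into `n` independent pairs with law `singleLaw`.
  have hlaw {V : (Fin p → ℂ) × ℝ → ℝ} (hV : Measurable V)
      (hVexp : ∫⁻ q, ENNReal.ofReal (Real.exp (|V q| / 2)) ∂(singleLaw p fZ) ≤ ENNReal.ofReal κ) :
      P {ω | 2 * n * (constC fZ b s).toReal * μ
        ≤ ∑ i, V (X ω i, Z ω i) - n * ∫ q, V q ∂(singleLaw p fZ)}
        ≤ tailBound n (constC fZ b s).toReal μ := by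
    have hVi (i : Fin n) : Measurable fun q : (Fin n → Fin p → ℂ) × (Fin n → ℝ) =>
        V (q.1 i, q.2 i) := hV.comp (by fun_prop)
    have hmeas : MeasurableSet {q : (Fin n → Fin p → ℂ) × (Fin n → ℝ) |
        2 * n * (constC fZ b s).toReal * μ
          ≤ ∑ i, V (q.1 i, q.2 i) - n * ∫ q, V q ∂(singleLaw p fZ)} :=
      measurableSet_le measurable_const
        ((Finset.measurable_fun_sum _ fun i _ => hVi i).sub measurable_const)
    rw [hXZ.measure_eq (p := fun q => 2 * n * (constC fZ b s).toReal * μ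
        ≤ ∑ i, V (q.1 i, q.2 i) - n * ∫ q, V q ∂(singleLaw p fZ)) hmeas, designNoiseLaw,
      ← (measurePreserving_arrowProdEquivProdArrow (Fin p → ℂ) ℝ (Fin n)
        (fun _ => Measure.pi fun _ => stdComplexGaussian) fun _ => noiseLaw fZ).measure_preimage
        hmeas.nullMeasurableSet]
    exact (measure_pi_le_sum_sub_le (ρ := singleLaw p fZ) hV ENNReal.toReal_nonneg hVexp hκC
      hμ).trans (ofReal_exp_le_tailBound hμ)
  constructor
  · have h := hlaw (V := fun q => -U q) hUm.neg (by simpa using hexp)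
    refine le_trans (measure_mono fun ω hω => ?_) h
    simp only [Set.mem_ofPred_eq, integral_neg, Finset.sum_neg_distrib] at hω ⊢
    rw [hinfo, condMutualInfo] at hω
    linarith
  · have h := hlaw hUm hexp
    simp_rw [hinfo]
    exact h
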